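/- Let $m,q\ge 0$, let $I$ and $\langle\cdot,\cdot\rangle$ be the standard complex structure and inner product of $\mathfrak m=\mathbb R^{2m}$, and let $\mathfrak h=\mathbb R^q$. Let $\mu$ be a Lie bracket on $\mathfrak g=\mathfrak h\oplus\mathfrak m=\mathbb R^{q+2m}$ such that $\mu(\mathfrak h,\mathfrak h)\subset\mathfrak h$, $\mu(\mathfrak h,\mathfrak m)\subset\mathfrak m$, and such that $\mathfrak h$ acts on $\mathfrak m$ through $\operatorname{ad}_\mu$ faithfully, by skew-symmetric endomorphisms commuting with $I$. For $X,Y\in\mathfrak m$ let $\mu_{\mathfrak h}(X,Y)$ and $\mu_{\mathfrak m}(X,Y)$ be the components of $\mu(X,Y)$, and put $$F^\mu(X,Y,Z)=-\langle\mu_{\mathfrak m}(IX,IY),Z\rangle-\langle\mu_{\mathfrak m}(IY,IZ),X\rangle-\langle\mu_{\mathfrak m}(IZ,IX),Y\rangle ,$$ $$N^\mu(X,Y)=\mu_{\mathfrak m}(IX,IY)-\mu_{\mathfrak m}(X,Y)-I\mu_{\mathfrak m}(IX,Y)-I\mu_{\mathfrak m}(X,IY),$$ $$\langle S^\mu(X)Y,Z\rangle=-\tfrac12\langle\mu_{\mathfrak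 m}(X,Y),Z\rangle-\tfrac12\langle\mu_{\mathfrak m}(Z,X),Y\rangle-\tfrac12\langle\mu_{\mathfrak m}(Z,Y),X\rangle ,$$ and, for $t\in\mathbb R$, $$\langle A^{t}(X)Y,Z\rangle=\langle S^\mu(X)Y,Z\rangle+\tfrac{t+1}4(F^\mu)^+(X,IY,IZ)+\tfrac{t-1}4(F^\mu)^+(X,Y,Z)+\tfrac14\langle N^\mu(Y,Z),X\rangle+\tfrac12(F^\mu)^-(X,Y,Z).$$ Here a three-form $\varphi$ on a space with complex structure $I$ is decomposed as $\varphi=\varphi^++\varphi^-$, where $\varphi^-(X,Y,Z)=\tfrac14\big(\varphi(X,Y,Z)-\varphi(IX,IY,Z)-\varphi(IX,Y,IZ)-\varphi(X,IY,IZ)\big)$ is its part of type $(3,0)+(0,3)$. Let $((M,J,g),p)$ be a pointed locally homogeneous almost-Hermitian space attached to $\mu$, that is, a representative of the local quotient $\mathsf G_\mu/\mathsf H_\mu$ with its invariant almost-Hermitian structure, pointed at the class of the identity. Explicitly: in a chart, $M$ is an open subset of $\mathbb R^{2m}$ with a smooth almost-Hermitian structure $(J,g)$, together with a linear map $a\mapsto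 K_a$ from $\mathfrak g$ to smooth real holomorphic Killing vector fields on $M$ (the fields induced by the left action, so that $[K_a,K_b]=-K_{\mu(a,b)}$) such that $K_Z(p)=0$ for $Z\in\mathfrak h$ and such that $\mathfrak m\to T_pM$, $X\mapsto K_X(p)$, is unitary from $(\mathfrak m,I,\langle\cdot,\cdot\rangle)$ to $(T_pM,J_p,g_p)$. Identify $\mathfrak m$ with $T_pM$ by this map. Let $D$ be the Levi-Civita connection of $g$, $\omega=g(J\cdot,\cdot)$, $d^c\omega=d\omega(J\cdot,J\cdot,J\cdot)$, $N_J(X,Y)=[JX,JY]-[X,Y]-J([JX,Y]+[X,JY])$, and let $\nabla^t$ be the $t$-Gauduchon connection, $$g(\nabla^t_XY,Z)=g(D_XY,Z)-\tfrac{t+1}4(d^c\omega)^+(X,JY,JZ)-\tfrac{t-1}4(d^c\omega)^+(X,Y,Z)-\tfrac14g(X,N_J(Y,Z))-\tfrac12(d^c\omega)^-(X,Y,Z).$$ Let $T^t(X,Y)=\nabla^t_XY-\nabla^t_YX-[X,Y]$ and $\Omega^t(X,Y)=\nabla^t_{[X,Y]}-[\nabla^t_X,\nabla^t_Y]$ be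 its torsion and curvature, and let $\widetilde D$ be the Ambrose-Singer connection determined by $\mathfrak g=\mathfrak h\oplus\mathfrak m$, so that $(\widetilde D_{X}W)_p=[K_X,W]_p$ for $X\in\mathfrak m$ and every vector field $W$. Then, at $p$, one has $d^c\omega=F^\mu$, $N_J=N^\mu$, $\widetilde D-D=S^\mu$, $\widetilde D-\nabla^t=A^t$, and for all $X,Y\in\mathfrak m$ $$T^t(X,Y)=-A^t(X)Y+A^t(Y)X-\mu_{\mathfrak m}(X,Y),$$ $$\Omega^t(X,Y)=\operatorname{ad}_\mu(\mu_{\mathfrak h}(X,Y))|_{\mathfrak m}-[A^t(X),A^t(Y)]-A^t(\mu_{\mathfrak m}(X,Y)).$$ -/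

import Mathlib

open scoped ContDiff

noncomputable section

namespace GauduchonHomogeneous

/-! ### The model space `ℝ^{2m}` and brackets -/

/-- The Euclidean space `ℝ^{2m}`, its standard basis being indexed by pairs
`e_{(i,0)}, e_{(i,1)}` (that is, `e_{2i-1}, e_{2i}`). -/
abbrev V (m : ℕ) : Type := EuclideanSpace ℝ (Fin m × Fin 2)

/-- The standard complex structure of `ℝ^{2m}`: `I e_{(i,0)} = e_{(i,1)}`,
`I e_{(i,1)} = - e_{(i,0)}`. -/
def stdI (m : ℕ) : V m →ₗ[ℝ] V m where
  toFun x := WithLp.toLp 2 fun ik => if ik.2 = 0 then -x (ik.1, 1) else x (ik.1, 0)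
  map_add' x y := by
    ext ik
    by_cases h : ik.2 = 0 <;> simp [h, add_comm]
  map_smul' a x := by
    ext ik
    by_cases h : ik.2 = 0 <;> simp [h]

/-- The space `ℝ^{q+2m} = ℝ^q ⊕ ℝ^{2m}`. -/
abbrev G (m q : ℕ) : Type := EuclideanSpace ℝ (Fin q) × V m

/-- Bilinear maps `ℝ^{q+2m} × ℝ^{q+2m} → ℝ^{q+2m}`. -/
abbrev Bracket (m q : ℕ) : Type := G m q →ₗ[ℝ] G m q →ₗ[ℝ] G m q

/-- `μ` is the bracket of a unitary transitive Lie algebra of rank `(m, q)` written in an adapted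
frame: `μ` is a Lie bracket on `ℝ^{q+2m}`, `𝔥 = ℝ^q` is a subalgebra, `𝔪 = ℝ^{2m}` is
`ad(𝔥)`-invariant, `𝔥` acts on `𝔪` by skew-symmetric endomorphisms commuting with the
standard complex structure, and this action is faithful. -/
structure IsUnitaryTransitive {m q : ℕ} (μ : Bracket m q) : Prop where
  skew : ∀ a, μ a a = 0
  jacobi : ∀ a b c, μ a (μ b c) + μ b (μ c a) + μ c (μ a b) = 0
  subalgebra : ∀ Z W : EuclideanSpace ℝ (Fin q), (μ (Z, 0) (W, 0)).2 = 0
  reductive : ∀ (Z : EuclideanSpace ℝ (Fin q)) (X : V m), (μ (Z, 0) (0, X)).1 = 0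
  ad_skew : ∀ (Z : EuclideanSpace ℝ (Fin q)) (X Y : V m),
    inner ℝ (μ (Z, 0) (0, X)).2 Y = -inner ℝ X (μ (Z, 0) (0, Y)).2
  ad_complex : ∀ (Z : EuclideanSpace ℝ (Fin q)) (X : V m),
    (μ (Z, 0) (0, stdI m X)).2 = stdI m (μ (Z, 0) (0, X)).2
  faithful : ∀ Z : EuclideanSpace ℝ (Fin q), (∀ X : V m, μ (Z, 0) (0, X) = 0) → Z = 0

section Algebra

variable {m q : ℕ} (μ : Bracket m q)

/-- The component `μ_𝔥 : 𝔪 × 𝔪 → 𝔥` of the bracket. -/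
def muH (X Y : V m) : EuclideanSpace ℝ (Fin q) := (μ (0, X) (0, Y)).1

/-- The component `μ_𝔪 : 𝔪 × 𝔪 → 𝔪` of the bracket. -/
def muM (X Y : V m) : V m := (μ (0, X) (0, Y)).2

/-- The endomorphism `ad(Z)|_𝔪` of `𝔪`, for `Z ∈ 𝔥`. -/
def adM (Z : EuclideanSpace ℝ (Fin q)) (X : V m) : V m := (μ (Z, 0) (0, X)).2

/-- The algebraic three-form `F^μ` on `ℝ^{2m}`. -/
def F (X Y Z : V m) : ℝ :=
  -inner ℝ (muM μ (stdI m X) (stdI m Y)) Z - inner ℝ (muM μ (stdI m Y) (stdI m Z)) X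
    - inner ℝ (muM μ (stdI m Z) (stdI m X)) Y

/-- The component `(F^μ)^-` of `F^μ` of type `(3,0)+(0,3)`. -/
def Fminus (X Y Z : V m) : ℝ :=
  (1 / 4) * (F μ X Y Z - F μ (stdI m X) (stdI m Y) Z - F μ (stdI m X) Y (stdI m Z)
    - F μ X (stdI m Y) (stdI m Z))

/-- The component `(F^μ)^+` of `F^μ` of type `(2,1)+(1,2)`. -/
def Fplus (X Y Z : V m) : ℝ := F μ X Y Z - Fminus μ X Y Z

/-- The algebraic Nijenhuis tensor `N^μ` on `ℝ^{2m}`. -/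
def N (X Y : V m) : V m :=
  muM μ (stdI m X) (stdI m Y) - muM μ X Y
    - stdI m (muM μ (stdI m X) Y + muM μ X (stdI m Y))

/-- The vector `v` of `ℝ^{2m}` with `⟨v, Z⟩ = φ Z` for all `Z`, for a linear form `φ`. -/
def ofInner (φ : V m → ℝ) : V m := WithLp.toLp 2 fun i => φ (EuclideanSpace.single i 1)

theorem inner_ofInner {φ : V m → ℝ} (hφ : IsLinearMap ℝ φ) (Z : V m) :
    inner ℝ (ofInner φ) Z = φ Z := by
  have h1 : φ Z = (hφ.mk' φ) Z := rfl
  have h2 : Z = ∑ i, Z i • (EuclideanSpace.single i (1 : ℝ) : V m) := by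
    have h := (EuclideanSpace.basisFun (Fin m × Fin 2) ℝ).sum_repr Z
    simpa using h.symm
  rw [h1]
  conv_rhs => rw [h2]
  rw [map_sum, PiLp.inner_apply]
  refine Finset.sum_congr rfl fun i _ => ?_
  simp [ofInner]

/-- The operator `S^μ : 𝔪 → 𝔰𝔬(𝔪)`. -/
def S (X Y : V m) : V m := ofInner fun Z =>
  -(1 / 2) * inner ℝ (muM μ X Y) Z - (1 / 2) * inner ℝ (muM μ Z X) Y
    - (1 / 2) * inner ℝ (muM μ Z Y) X

/-- The operator `A^{t,μ} : 𝔪 → 𝔲(𝔪)`. -/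
def A (t : ℝ) (X Y : V m) : V m := ofInner fun Z =>
  inner ℝ (S μ X Y) Z
    + (t + 1) / 4 * Fplus μ X (stdI m Y) (stdI m Z) + (t - 1) / 4 * Fplus μ X Y Z
    + (1 / 4) * inner ℝ (N μ Y Z) X + (1 / 2) * Fminus μ X Y Z

theorem muM_add_left (X X' Y : V m) : muM μ (X + X') Y = muM μ X Y + muM μ X' Y := by
  have h : ((0, X + X') : G m q) = (0, X) + (0, X') := by simp
  simp [muM, h, -Prod.mk_add_mk]

theorem muM_add_right (X Y Y' : V m) : muM μ X (Y + Y') = muM μ X Y + muM μ X Y' := by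
  have h : ((0, Y + Y') : G m q) = (0, Y) + (0, Y') := by simp
  simp [muM, h, -Prod.mk_add_mk]

theorem muM_smul_left (a : ℝ) (X Y : V m) : muM μ (a • X) Y = a • muM μ X Y := by
  have h : ((0, a • X) : G m q) = a • (0, X) := by simp
  simp [muM, h, -Prod.smul_mk]

theorem muM_smul_right (a : ℝ) (X Y : V m) : muM μ X (a • Y) = a • muM μ X Y := by
  have h : ((0, a • Y) : G m q) = a • (0, Y) := by simp
  simp [muM, h, -Prod.smul_mk]

/-- The defining property of `S^μ`. -/
theorem inner_S (X Y Z : V m) : inner ℝ (S μ X Y) Z =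
    -(1 / 2) * inner ℝ (muM μ X Y) Z - (1 / 2) * inner ℝ (muM μ Z X) Y
      - (1 / 2) * inner ℝ (muM μ Z Y) X := by
  refine inner_ofInner (φ := fun Z => -(1 / 2) * inner ℝ (muM μ X Y) Z
    - (1 / 2) * inner ℝ (muM μ Z X) Y - (1 / 2) * inner ℝ (muM μ Z Y) X) ⟨?_, ?_⟩ Z
  · intro Z Z'
    simp only [muM_add_left, inner_add_left, inner_add_right]
    ring
  · intro a Z
    simp only [muM_smul_left, inner_smul_left, inner_smul_right, smul_eq_mul,
      RCLike.conj_to_real]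
    ring

/-- The defining property of `A^{t,μ}`. -/
theorem inner_A (t : ℝ) (X Y Z : V m) : inner ℝ (A μ t X Y) Z =
    inner ℝ (S μ X Y) Z
      + (t + 1) / 4 * Fplus μ X (stdI m Y) (stdI m Z) + (t - 1) / 4 * Fplus μ X Y Z
      + (1 / 4) * inner ℝ (N μ Y Z) X + (1 / 2) * Fminus μ X Y Z := by
  refine inner_ofInner (φ := fun Z => inner ℝ (S μ X Y) Z
      + (t + 1) / 4 * Fplus μ X (stdI m Y) (stdI m Z) + (t - 1) / 4 * Fplus μ X Y Z
      + (1 / 4) * inner ℝ (N μ Y Z) X + (1 / 2) * Fminus μ X Y Z) ⟨?_, ?_⟩ Z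
  · intro Z Z'
    simp only [Fplus, Fminus, F, N, map_add, muM_add_left, muM_add_right, inner_add_left,
      inner_add_right, inner_sub_left]
    ring
  · intro a Z
    simp only [Fplus, Fminus, F, N, map_add, map_smul, muM_smul_left, muM_smul_right,
      inner_add_left, inner_sub_left, inner_smul_left, inner_smul_right, smul_eq_mul,
      RCLike.conj_to_real]
    ring

end Algebra

/-! ### Almost-Hermitian geometry in a coordinate chart -/

section Geometry

variable {m : ℕ}

/-- A field of bilinear forms (`g x X Y = g_x(X, Y)`). -/
abbrev MetricField (m : ℕ) : Type := V m → V m →L[ℝ] V m →L[ℝ] ℝ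

/-- A field of endomorphisms. -/
abbrev EndField (m : ℕ) : Type := V m → V m →L[ℝ] V m

/-- `(g, J)` is a smooth almost-Hermitian structure on the set `U` of `ℝ^{2m}`. -/
structure IsAlmostHermitian (U : Set (V m)) (g : MetricField m) (J : EndField m) : Prop where
  smooth_g : ContDiffOn ℝ ∞ g U
  smooth_J : ContDiffOn ℝ ∞ J U
  symm : ∀ x ∈ U, ∀ X Y, g x X Y = g x Y X
  pos : ∀ x ∈ U, ∀ X, X ≠ 0 → 0 < g x X X
  J_sq : ∀ x ∈ U, ∀ X, J x (J x X) = -X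
  J_isom : ∀ x ∈ U, ∀ X Y, g x (J x X) (J x Y) = g x X Y

variable (g : MetricField m) (J : EndField m)

/-- The tangent vector `v` at `x` with `g_x(v, Z) = φ(Z)` for all `Z`. -/
def sharp (x : V m) (φ : V m →L[ℝ] ℝ) : V m := (g x).inverse φ

/-- The Levi-Civita connection coefficients:
`2 g(Γ(X,Y), Z) = ∂_X g(Y,Z) + ∂_Y g(X,Z) - ∂_Z g(X,Y)`. -/
def christoffel (x X Y : V m) : V m :=
  sharp g x ((1 / 2 : ℝ) • (fderiv ℝ g x X Y + fderiv ℝ g x Y X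
    - ((fderiv ℝ g x).flip X).flip Y))

/-- The fundamental form `ω = g(J·,·)`. -/
def omega (x : V m) : V m →L[ℝ] V m →L[ℝ] ℝ := (g x).comp (J x)

/-- The exterior derivative
`dω(X,Y,Z) = ∂_X ω(Y,Z) + ∂_Y ω(Z,X) + ∂_Z ω(X,Y)`, as a linear form in `Z`. -/
def dOmega (x X Y : V m) : V m →L[ℝ] ℝ :=
  fderiv ℝ (omega g J) x X Y + (fderiv ℝ (omega g J) x Y).flip X
    + ((fderiv ℝ (omega g J) x).flip X).flip Y

/-- The three-form `dᶜω = J⁻¹ d J ω`, that is, `dᶜω(X,Y,Z) = dω(JX,JY,JZ)` (because `Jω = ω`, and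
`J⁻¹` acts on forms by composing each argument with `J`). -/
def dcOmega (x X Y : V m) : V m →L[ℝ] ℝ := (dOmega g J x (J x X) (J x Y)).comp (J x)

/-- The component `(dᶜω)^-` of type `(3,0)+(0,3)`, as a linear form in the last argument. -/
def dcOmegaMinus (x X Y : V m) : V m →L[ℝ] ℝ :=
  (1 / 4 : ℝ) • (dcOmega g J x X Y - dcOmega g J x (J x X) (J x Y)
    - (dcOmega g J x (J x X) Y).comp (J x) - (dcOmega g J x X (J x Y)).comp (J x))

/-- The component `(dᶜω)^+` of type `(2,1)+(1,2)`, as a linear form in the last argument. -/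
def dcOmegaPlus (x X Y : V m) : V m →L[ℝ] ℝ := dcOmega g J x X Y - dcOmegaMinus g J x X Y

/-- The Nijenhuis tensor `N_J(X,Y) = [JX,JY] - [X,Y] - J([JX,Y] + [X,JY])` evaluated on constant
vector fields `X`, `Y`, as a linear map in `Y`. -/
def nijenhuis (x X : V m) : V m →L[ℝ] V m :=
  fderiv ℝ J x (J x X) - ((fderiv ℝ J x).flip X).comp (J x)
    - (J x).comp (fderiv ℝ J x X - (fderiv ℝ J x).flip X)

/-- The formula for `N_J` in terms of Lie brackets of vector fields. -/
theorem nijenhuis_apply {x : V m} (hJ : DifferentiableAt ℝ J x) (X Y : V m) :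
    nijenhuis J x X Y =
      VectorField.lieBracket ℝ (fun y => J y X) (fun y => J y Y) x
        - VectorField.lieBracket ℝ (fun _ => X) (fun _ => Y) x
        - J x (VectorField.lieBracket ℝ (fun y => J y X) (fun _ => Y) x
            + VectorField.lieBracket ℝ (fun _ => X) (fun y => J y Y) x) := by
  have h : ∀ W Z : V m, fderiv ℝ (fun y => J y W) x Z = fderiv ℝ J x Z W := by
    intro W Z
    rw [fderiv_clm_apply hJ (differentiableAt_const W)]
    simp
  simp [nijenhuis, VectorField.lieBracket, h]
  abel

/-- The connection coefficients of the `t`-Gauduchon connection, given by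
`g(∇ᵗ_X Y, Z) = g(D_X Y, Z) - (t+1)/4 (dᶜω)^+(X,JY,JZ) - (t-1)/4 (dᶜω)^+(X,Y,Z)
  - 1/4 g(X, N_J(Y,Z)) - 1/2 (dᶜω)^-(X,Y,Z)`. -/
def gauduchon (t : ℝ) (x X Y : V m) : V m :=
  christoffel g x X Y - sharp g x
    (((t + 1) / 4) • (dcOmegaPlus g J x X (J x Y)).comp (J x)
      + ((t - 1) / 4) • dcOmegaPlus g J x X Y
      + (1 / 4 : ℝ) • (g x X).comp (nijenhuis J x Y)
      + (1 / 2 : ℝ) • dcOmegaMinus g J x X Y)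

variable (Γ : V m → V m → V m → V m)

/-- The covariant derivative `∇_X Y` of vector fields with connection coefficients `Γ`. -/
def nabla (X Y : V m → V m) : V m → V m := fun x =>
  fderiv ℝ Y x (X x) + Γ x (X x) (Y x)

/-- The torsion `∇_X Y - ∇_Y X - [X,Y]`. -/
def torsion (X Y : V m → V m) : V m → V m := fun x =>
  nabla Γ X Y x - nabla Γ Y X x - VectorField.lieBracket ℝ X Y x

/-- The curvature operator `(∇_{[X,Y]} - [∇_X, ∇_Y]) Z`. -/
def curvature (X Y Z : V m → V m) : V m → V m := fun x =>
  nabla Γ (VectorField.lieBracket ℝ X Y) Z x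
    - (nabla Γ X (nabla Γ Y Z) x - nabla Γ Y (nabla Γ X Z) x)

end Geometry

/-! ### The locally homogeneous space attached to a bracket -/

/-- A pointed locally homogeneous almost-Hermitian space `((U, J, g), p)` attached to the bracket
`μ`, i.e. a representative, written in a coordinate chart, of the local quotient `G_μ/H_μ` with its
invariant structure, pointed at the class of the identity.

`K` is the infinitesimal action of the Lie algebra `(ℝ^{q+2m}, μ)`: `K a` is the vector field
induced by the one-parameter group `exp(s a)` acting from the left on `G_μ/H_μ` (so that
`[K a, K b] = - K (μ a b)`). These fields are real holomorphic and Killing, the isotropy subalgebra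
at `p` contains `𝔥 = ℝ^q`, and `X ↦ (K X)_p` is a unitary identification of `𝔪 = ℝ^{2m}` with
the tangent space at `p`. -/
structure AttachedSpace {m q : ℕ} (μ : Bracket m q) where
  U : Set (V m)
  isOpen_U : IsOpen U
  p : V m
  p_mem : p ∈ U
  g : MetricField m
  J : EndField m
  almostHermitian : IsAlmostHermitian U g J
  K : G m q →ₗ[ℝ] (V m → V m)
  smooth_K : ∀ a, ContDiffOn ℝ ∞ (K a) U
  bracket_K : ∀ a b, ∀ x ∈ U, VectorField.lieBracket ℝ (K a) (K b) x = -K (μ a b) x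
  /-- `(L_{K a} g)(Y, Z) = 0` -/
  killing : ∀ a, ∀ x ∈ U, ∀ Y Z : V m,
    fderiv ℝ (fun y => g y Y Z) x (K a x)
      - g x (VectorField.lieBracket ℝ (K a) (fun _ => Y) x) Z
      - g x Y (VectorField.lieBracket ℝ (K a) (fun _ => Z) x) = 0
  /-- `(L_{K a} J) Y = 0` -/
  holomorphic : ∀ a, ∀ x ∈ U, ∀ Y : V m,
    VectorField.lieBracket ℝ (K a) (fun y => J y Y) x
      - J x (VectorField.lieBracket ℝ (K a) (fun _ => Y) x) = 0
  isotropy : ∀ Z : EuclideanSpace ℝ (Fin q), K (Z, 0) p = 0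
  isometry : ∀ X Y : V m, g p (K (0, X) p) (K (0, Y) p) = inner ℝ X Y
  complex : ∀ X : V m, J p (K (0, X) p) = K (0, stdI m X) p

namespace AttachedSpace

variable {m q : ℕ} {μ : Bracket m q} (M : AttachedSpace μ)

/-- The identification `ℝ^{2m} ≃ T_pU`, `X ↦ (K X)_p`. -/
def e (X : V m) : V m := M.K (0, X) M.p

/-- The covariant derivative at `p` of a vector field `W`, in the direction `e X`, with respect to
the Ambrose-Singer connection determined by the reductive decomposition `𝔤 = 𝔥 + 𝔪`: it is the
derivative of `W` along the flow of the left action of `exp(s X)`, `X ∈ 𝔪`. -/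
def ambroseSinger (X : V m) (W : V m → V m) : V m :=
  VectorField.lieBracket ℝ (M.K (0, X)) W M.p

end AttachedSpace

end GauduchonHomogeneous

end

namespace GauduchonHomogeneous

set_option maxSynthPendingDepth 3

/-! ### Calculus along a line -/

/-! The fields `K a` play the role of the group. Since `L_{K a} g = 0` and `L_{K a} J = 0`, the
derivatives of `g` and `J` at `p` along `e X` are expressed through the differential dK_X of `K (0,
X)` at `p`. The bracket relation gives dK_X(e Y) - dK_Y(e X) = e(μ_𝔪(X,Y)) (`fderiv_K_sub`), so dᶜω
and N_J, in which the dK enter only through such differences, become `F μ` and `N μ`. In the Koszul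
formula one dK_X is left over: the Levi-Civita coefficient is -dK_X(e Y) - e(S(X)Y). As -dK_X is the
coefficient of the Ambrose-Singer connection, the comparison with D follows; subtracting the
remaining tensor gives ∇ᵗ (`gauduchon_e`), and then its torsion.

The curvature needs the derivative of the coefficients Γ of ∇ᵗ. It comes from naturality: along an
infinitesimal automorphism ξ, the derivative of Γ is determined by Γ, dξ and d²ξ
(`fderiv_gauduchon`). Applied to K_X and K_Y, this leaves second derivatives of these fields, which
the differentiated bracket relation `fderiv_bracket_K` evaluates. There the 𝔥-component of μ(X,Y)
produces ad(μ_𝔥(X,Y)), because its field vanishes at `p` and has the isotropy representation as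
linear part; the 𝔪-component cancels the non-tensorial part of Γ(e μ_𝔪(X,Y), ·). -/

theorem hasDerivAt_line {E F : Type*} [NormedAddCommGroup E] [NormedSpace ℝ E]
    [NormedAddCommGroup F] [NormedSpace ℝ F] {f : E → F} {p : E}
    (hf : DifferentiableAt ℝ f p) (k : E) :
    HasDerivAt (fun s : ℝ => f (p + s • k)) (fderiv ℝ f p k) 0 :=
  hf.hasFDerivAt.hasLineDerivAt k

theorem eventually_line_mem {E : Type*} [NormedAddCommGroup E] [NormedSpace ℝ E]
    {U : Set E} (hU : IsOpen U) {p : E} (hp : p ∈ U) (k : E) :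
    ∀ᶠ s : ℝ in nhds 0, p + s • k ∈ U := by
  have hc : ContinuousAt (fun s : ℝ => p + s • k) 0 := by fun_prop
  exact hc.eventually_mem (hU.mem_nhds (by simpa using hp))

theorem differentiableAt_clm_flip {D E F G : Type*} [NormedAddCommGroup D] [NormedSpace ℝ D]
    [NormedAddCommGroup E] [NormedSpace ℝ E] [NormedAddCommGroup F] [NormedSpace ℝ F]
    [NormedAddCommGroup G] [NormedSpace ℝ G] {f : D → E →L[ℝ] F →L[ℝ] G} {p : D}
    (hf : DifferentiableAt ℝ f p) : DifferentiableAt ℝ (fun x => (f x).flip) p :=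
  ((ContinuousLinearMap.flipₗᵢ ℝ E F G).toContinuousLinearEquiv.toContinuousLinearMap.hasFDerivAt.comp
    p hf.hasFDerivAt).differentiableAt

theorem differentiableAt_of_contDiffOn {E F : Type*} [NormedAddCommGroup E]
    [NormedSpace ℝ E] [NormedAddCommGroup F] [NormedSpace ℝ F] {f : E → F} {U : Set E}
    (hf : ContDiffOn ℝ ∞ f U) (hU : IsOpen U) {p : E} (hp : p ∈ U) : DifferentiableAt ℝ f p :=
  (hf.contDiffAt (hU.mem_nhds hp)).differentiableAt (by simp)

theorem differentiableAt_fderiv_of_contDiffOn {E F : Type*} [NormedAddCommGroup E]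
    [NormedSpace ℝ E] [NormedAddCommGroup F] [NormedSpace ℝ F] {f : E → F} {U : Set E}
    (hf : ContDiffOn ℝ ∞ f U) (hU : IsOpen U) {p : E} (hp : p ∈ U) :
    DifferentiableAt ℝ (fderiv ℝ f) p :=
  differentiableAt_of_contDiffOn (hf.fderiv_of_isOpen hU (by simp)) hU hp

theorem fderiv_fderiv_symm_of_contDiffOn {E F : Type*} [NormedAddCommGroup E]
    [NormedSpace ℝ E] [NormedAddCommGroup F] [NormedSpace ℝ F] {f : E → F} {U : Set E}
    (hf : ContDiffOn ℝ ∞ f U) (hU : IsOpen U) {p : E} (hp : p ∈ U) (X Y : E) :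
    fderiv ℝ (fderiv ℝ f) p X Y = fderiv ℝ (fderiv ℝ f) p Y X :=
  (hf.contDiffAt (hU.mem_nhds hp)).isSymmSndFDerivAt
    (by simpa using ENat.LEInfty.out) X Y

/-! ### Invariant tensor fields -/

section Invariance

variable {m : ℕ}

/-- `h` is a field of bilinear forms with `L_ξ h = 0` on `U`. -/
def IsInvariantForm (U : Set (V m)) (ξ : V m → V m) (h : MetricField m) : Prop :=
  ∀ x ∈ U, ∀ Y Z, fderiv ℝ h x (ξ x) Y Z = -h x (fderiv ℝ ξ x Y) Z - h x Y (fderiv ℝ ξ x Z)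

/-- `J` is a field of endomorphisms with `L_ξ J = 0` on `U`. -/
def IsInvariantEnd (U : Set (V m)) (ξ : V m → V m) (J : EndField m) : Prop :=
  ∀ x ∈ U, ∀ Y, fderiv ℝ J x (ξ x) Y = fderiv ℝ ξ x (J x Y) - J x (fderiv ℝ ξ x Y)

/-- `L_ξ φ = 0` at `p`, for a field `φ` of trilinear forms. -/
def IsInvariantTrilinear (ξ : V m → V m) (p : V m) (φ : V m → V m → V m → V m → ℝ) : Prop :=
  ∀ (X Y Z : ℝ → V m) (X' Y' Z' : V m),
    HasDerivAt X X' 0 → HasDerivAt Y Y' 0 → HasDerivAt Z Z' 0 →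
    HasDerivAt (fun s : ℝ => φ (p + s • ξ p) (X s) (Y s) (Z s))
      (φ p (X' - fderiv ℝ ξ p (X 0)) (Y 0) (Z 0) + φ p (X 0) (Y' - fderiv ℝ ξ p (Y 0)) (Z 0)
        + φ p (X 0) (Y 0) (Z' - fderiv ℝ ξ p (Z 0))) 0

variable {U : Set (V m)} {ξ : V m → V m} {h g : MetricField m} {J : EndField m} {p : V m}

/-- Differentiate the equation `L_ξ h = 0` in the direction `X`, then exchange `X` and `ξ p` by
symmetry of the second derivative of `h`. -/
theorem IsInvariantForm.fderiv_fderiv (hU : IsOpen U) (hp : p ∈ U) (hξ : ContDiffOn ℝ ∞ ξ U)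
    (hh : ContDiffOn ℝ ∞ h U) (inv : IsInvariantForm U ξ h) (X Y Z : V m) :
    fderiv ℝ (fderiv ℝ h) p (ξ p) X Y Z =
      -fderiv ℝ h p (fderiv ℝ ξ p X) Y Z - fderiv ℝ h p X (fderiv ℝ ξ p Y) Z
        - fderiv ℝ h p X Y (fderiv ℝ ξ p Z)
        - h p (fderiv ℝ (fderiv ℝ ξ) p X Y) Z - h p Y (fderiv ℝ (fderiv ℝ ξ) p X Z) := by
  have d0 := hasDerivAt_line (differentiableAt_of_contDiffOn hh hU hp) X
  have d1 := hasDerivAt_line (differentiableAt_fderiv_of_contDiffOn hh hU hp) X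
  have e0 := hasDerivAt_line (differentiableAt_of_contDiffOn hξ hU hp) X
  have e1 := hasDerivAt_line (differentiableAt_fderiv_of_contDiffOn hξ hU hp) X
  have c : ∀ W : V m, HasDerivAt (fun _ : ℝ => W) 0 0 := fun W => hasDerivAt_const _ _
  have L := ((d1.clm_apply e0).clm_apply (c Y)).clm_apply (c Z)
  have R := ((d0.clm_apply (e1.clm_apply (c Y))).clm_apply (c Z)).neg.sub
    ((d0.clm_apply (c Y)).clm_apply (e1.clm_apply (c Z)))
  -- Invariance holds on all of the open set `U`, so both sides agree along the line for small `s`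
  -- and have equal derivatives.
  have E := L.unique (R.congr_of_eventuallyEq (by
    filter_upwards [eventually_line_mem hU hp X] with s hs
    simpa using inv _ hs Y Z))
  rw [fderiv_fderiv_symm_of_contDiffOn hh hU hp]
  simp at E
  linarith

theorem IsInvariantEnd.fderiv_fderiv (hU : IsOpen U) (hp : p ∈ U) (hξ : ContDiffOn ℝ ∞ ξ U)
    (hJ : ContDiffOn ℝ ∞ J U) (inv : IsInvariantEnd U ξ J) (X Y : V m) :
    fderiv ℝ (fderiv ℝ J) p (ξ p) X Y =
      fderiv ℝ ξ p (fderiv ℝ J p X Y) - fderiv ℝ J p (fderiv ℝ ξ p X) Y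
        - fderiv ℝ J p X (fderiv ℝ ξ p Y)
        + fderiv ℝ (fderiv ℝ ξ) p X (J p Y) - J p (fderiv ℝ (fderiv ℝ ξ) p X Y) := by
  have d0 := hasDerivAt_line (differentiableAt_of_contDiffOn hJ hU hp) X
  have d1 := hasDerivAt_line (differentiableAt_fderiv_of_contDiffOn hJ hU hp) X
  have e0 := hasDerivAt_line (differentiableAt_of_contDiffOn hξ hU hp) X
  have e1 := hasDerivAt_line (differentiableAt_fderiv_of_contDiffOn hξ hU hp) X
  have c : ∀ W : V m, HasDerivAt (fun _ : ℝ => W) 0 0 := fun W => hasDerivAt_const _ _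
  have L := (d1.clm_apply e0).clm_apply (c Y)
  have R := (e1.clm_apply (d0.clm_apply (c Y))).sub (d0.clm_apply (e1.clm_apply (c Y)))
  have E := L.unique (R.congr_of_eventuallyEq (by
    filter_upwards [eventually_line_mem hU hp X] with s hs
    simpa using inv _ hs Y))
  rw [fderiv_fderiv_symm_of_contDiffOn hJ hU hp]
  simp at E
  rw [eq_sub_of_add_eq E]
  abel

theorem IsInvariantForm.hasDerivAt (hU : IsOpen U) (hp : p ∈ U)
    (hh : ContDiffOn ℝ ∞ h U) (inv : IsInvariantForm U ξ h)
    {X Y : ℝ → V m} {X' Y' : V m} (hX : HasDerivAt X X' 0) (hY : HasDerivAt Y Y' 0) :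
    HasDerivAt (fun s : ℝ => h (p + s • ξ p) (X s) (Y s))
      (h p (X' - fderiv ℝ ξ p (X 0)) (Y 0) + h p (X 0) (Y' - fderiv ℝ ξ p (Y 0))) 0 := by
  have d0 := hasDerivAt_line (differentiableAt_of_contDiffOn hh hU hp) (ξ p)
  refine ((d0.clm_apply hX).clm_apply hY).congr_deriv ?_
  simp [inv p hp]
  ring

theorem IsInvariantEnd.hasDerivAt (hU : IsOpen U) (hp : p ∈ U)
    (hJ : ContDiffOn ℝ ∞ J U) (inv : IsInvariantEnd U ξ J)
    {X : ℝ → V m} {X' : V m} (hX : HasDerivAt X X' 0) :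
    HasDerivAt (fun s : ℝ => J (p + s • ξ p) (X s))
      (fderiv ℝ ξ p (J p (X 0)) + J p (X' - fderiv ℝ ξ p (X 0))) 0 := by
  have d0 := hasDerivAt_line (differentiableAt_of_contDiffOn hJ hU hp) (ξ p)
  refine (d0.clm_apply hX).congr_deriv ?_
  simp [inv p hp]
  abel

theorem IsInvariantTrilinear.add {φ ψ : V m → V m → V m → V m → ℝ}
    (hφ : IsInvariantTrilinear ξ p φ) (hψ : IsInvariantTrilinear ξ p ψ) :
    IsInvariantTrilinear ξ p fun x X Y Z => φ x X Y Z + ψ x X Y Z := by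
  intro X Y Z X' Y' Z' hX hY hZ
  refine ((hφ X Y Z X' Y' Z' hX hY hZ).add (hψ X Y Z X' Y' Z' hX hY hZ)).congr_deriv ?_
  ring

theorem IsInvariantTrilinear.const_mul {φ : V m → V m → V m → V m → ℝ}
    (hφ : IsInvariantTrilinear ξ p φ) (c : ℝ) :
    IsInvariantTrilinear ξ p fun x X Y Z => c * φ x X Y Z := by
  intro X Y Z X' Y' Z' hX hY hZ
  refine ((hφ X Y Z X' Y' Z' hX hY hZ).const_mul c).congr_deriv ?_
  ring

theorem IsInvariantTrilinear.sub {φ ψ : V m → V m → V m → V m → ℝ}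
    (hφ : IsInvariantTrilinear ξ p φ) (hψ : IsInvariantTrilinear ξ p ψ) :
    IsInvariantTrilinear ξ p fun x X Y Z => φ x X Y Z - ψ x X Y Z := by
  simpa [sub_eq_add_neg] using hφ.add (hψ.const_mul (-1))

/-- Cyclic permutations of the arguments preserve invariance. -/
theorem IsInvariantTrilinear.cycle {φ : V m → V m → V m → V m → ℝ}
    (hφ : IsInvariantTrilinear ξ p φ) :
    IsInvariantTrilinear ξ p fun x X Y Z => φ x Y Z X := by
  intro X Y Z X' Y' Z' hX hY hZ
  refine (hφ Y Z X Y' Z' X' hY hZ hX).congr_deriv ?_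
  ring

/-- Invariance is tested on arbitrary curves of vectors, so the curve `J (p + s • ξ p) (X s)` may be
inserted; its derivative, corrected by dξ, is `J` of the corrected derivative of `X`. -/
theorem IsInvariantTrilinear.comp_left {φ : V m → V m → V m → V m → ℝ}
    (hφ : IsInvariantTrilinear ξ p φ) (hU : IsOpen U) (hp : p ∈ U)
    (hJ : ContDiffOn ℝ ∞ J U) (inv : IsInvariantEnd U ξ J) :
    IsInvariantTrilinear ξ p fun x X Y Z => φ x (J x X) Y Z := by
  intro X Y Z X' Y' Z' hX hY hZ
  refine (hφ _ Y Z _ Y' Z' (inv.hasDerivAt hU hp hJ hX) hY hZ).congr_deriv ?_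
  simp

theorem IsInvariantTrilinear.comp_middle {φ : V m → V m → V m → V m → ℝ}
    (hφ : IsInvariantTrilinear ξ p φ) (hU : IsOpen U) (hp : p ∈ U)
    (hJ : ContDiffOn ℝ ∞ J U) (inv : IsInvariantEnd U ξ J) :
    IsInvariantTrilinear ξ p fun x X Y Z => φ x X (J x Y) Z :=
  (hφ.cycle.cycle.comp_left hU hp hJ inv).cycle

theorem IsInvariantTrilinear.comp_right {φ : V m → V m → V m → V m → ℝ}
    (hφ : IsInvariantTrilinear ξ p φ) (hU : IsOpen U) (hp : p ∈ U)
    (hJ : ContDiffOn ℝ ∞ J U) (inv : IsInvariantEnd U ξ J) :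
    IsInvariantTrilinear ξ p fun x X Y Z => φ x X Y (J x Z) :=
  (hφ.cycle.comp_left hU hp hJ inv).cycle.cycle

end Invariance

section Invariance

variable {m : ℕ} {U : Set (V m)} {ξ : V m → V m} {g : MetricField m} {J : EndField m} {p : V m}

/-! ### Nondegeneracy -/

theorem IsAlmostHermitian.ext (hH : IsAlmostHermitian U g J) (hp : p ∈ U) {v w : V m}
    (h : ∀ Z, g p v Z = g p w Z) : v = w := by
  by_contra hvw
  have h1 := hH.pos p hp (v - w) (sub_ne_zero.2 hvw)
  have h2 := h (v - w)
  simp only [map_sub, sub_apply] at h1 h2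
  linarith

/-- Positivity makes `g p` injective, and the dual has the same dimension. Hence `inverse` in
`sharp` is a true inverse, not its default value. -/
theorem IsAlmostHermitian.isInvertible (hH : IsAlmostHermitian U g J) (hp : p ∈ U) :
    (g p).IsInvertible := by
  have hinj : Function.Injective (g p : V m →ₗ[ℝ] V m →L[ℝ] ℝ) := fun v w h =>
    hH.ext hp fun Z => congrArg (fun φ : V m →L[ℝ] ℝ => φ Z) h
  have hdim : Module.finrank ℝ (V m) = Module.finrank ℝ (V m →L[ℝ] ℝ) := by
    rw [← (LinearMap.toContinuousLinearMap (𝕜 := ℝ) (E := V m) (F' := ℝ)).finrank_eq]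
    exact Subspace.dual_finrank_eq.symm
  exact ⟨(LinearMap.linearEquivOfInjective _ hinj hdim).toContinuousLinearEquiv, by ext; rfl⟩

theorem IsAlmostHermitian.apply_sharp (hH : IsAlmostHermitian U g J) (hp : p ∈ U)
    (φ : V m →L[ℝ] ℝ) (Z : V m) : g p (sharp g p φ) Z = φ Z := by
  obtain ⟨e, he⟩ := hH.isInvertible hp
  rw [sharp, ← he]
  simp

theorem IsAlmostHermitian.differentiableAt_sharp (hH : IsAlmostHermitian U g J) (hU : IsOpen U)
    (hp : p ∈ U) {φ : V m → V m →L[ℝ] ℝ} (hφ : DifferentiableAt ℝ φ p) :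
    DifferentiableAt ℝ (fun x => sharp g x (φ x)) p := by
  have h1 : DifferentiableAt ℝ (fun x => (g x).inverse) p :=
    (((hH.isInvertible hp).contDiffAt_map_inverse (n := 1)).differentiableAt (by simp)).comp p
      (differentiableAt_of_contDiffOn hH.smooth_g hU hp)
  exact h1.clm_apply hφ

/-! ### The fundamental form and its derivatives -/

theorem IsAlmostHermitian.smooth_omega (hH : IsAlmostHermitian U g J) :
    ContDiffOn ℝ ∞ (omega g J) U :=
  hH.smooth_g.clm_comp hH.smooth_J

theorem IsAlmostHermitian.omega_neg (hH : IsAlmostHermitian U g J) (hp : p ∈ U) (X Y : V m) :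
    omega g J p X Y = -omega g J p Y X := by
  have h := hH.J_isom p hp X (J p Y)
  rw [hH.J_sq p hp] at h
  simp only [omega, ContinuousLinearMap.comp_apply]
  rw [hH.symm p hp (J p Y) X, ← h]
  simp

theorem IsInvariantForm.omega (hH : IsAlmostHermitian U g J) (hU : IsOpen U)
    (hg : IsInvariantForm U ξ g) (hJ : IsInvariantEnd U ξ J) :
    IsInvariantForm U ξ (omega g J) := by
  intro x hx Y Z
  have hd : HasFDerivAt (GauduchonHomogeneous.omega g J) _ x :=
    (differentiableAt_of_contDiffOn hH.smooth_g hU hx).hasFDerivAt.clm_comp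
      (differentiableAt_of_contDiffOn hH.smooth_J hU hx).hasFDerivAt
  rw [hd.fderiv]
  simp [GauduchonHomogeneous.omega, hg x hx, hJ x hx]
  ring

/-- The derivative of dω involves d²ξ in six terms; they cancel in pairs because d²ξ is symmetric
and ω is skew. -/
theorem isInvariantTrilinear_dOmega (hH : IsAlmostHermitian U g J) (hU : IsOpen U) (hp : p ∈ U)
    (hξ : ContDiffOn ℝ ∞ ξ U) (hg : IsInvariantForm U ξ g) (hJ : IsInvariantEnd U ξ J) :
    IsInvariantTrilinear ξ p fun x X Y Z => dOmega g J x X Y Z := by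
  intro X Y Z X' Y' Z' hX hY hZ
  have d := hasDerivAt_line (differentiableAt_fderiv_of_contDiffOn hH.smooth_omega hU hp) (ξ p)
  have h2 := (hg.omega hH hU hJ).fderiv_fderiv hU hp hξ hH.smooth_omega
  refine ((((d.clm_apply hX).clm_apply hY).clm_apply hZ).add
    (((d.clm_apply hY).clm_apply hZ).clm_apply hX) |>.add
    (((d.clm_apply hZ).clm_apply hX).clm_apply hY)).congr_deriv ?_
  have s := fderiv_fderiv_symm_of_contDiffOn hξ hU hp
  have n := hH.omega_neg hp
  simp [h2, dOmega]
  rw [n (Y 0) (fderiv ℝ (fderiv ℝ ξ) p (X 0) (Z 0)), n (Z 0), n (X 0), s (Y 0) (X 0),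
    s (Z 0) (X 0), s (Z 0) (Y 0)]
  ring

theorem isInvariantTrilinear_dcOmega (hH : IsAlmostHermitian U g J) (hU : IsOpen U) (hp : p ∈ U)
    (hξ : ContDiffOn ℝ ∞ ξ U) (hg : IsInvariantForm U ξ g) (hJ : IsInvariantEnd U ξ J) :
    IsInvariantTrilinear ξ p fun x X Y Z => dcOmega g J x X Y Z :=
  (((isInvariantTrilinear_dOmega hH hU hp hξ hg hJ).comp_left hU hp hH.smooth_J hJ).comp_middle
    hU hp hH.smooth_J hJ).comp_right hU hp hH.smooth_J hJ

theorem isInvariantTrilinear_dcOmegaMinus (hH : IsAlmostHermitian U g J) (hU : IsOpen U)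
    (hp : p ∈ U) (hξ : ContDiffOn ℝ ∞ ξ U) (hg : IsInvariantForm U ξ g)
    (hJ : IsInvariantEnd U ξ J) :
    IsInvariantTrilinear ξ p fun x X Y Z => dcOmegaMinus g J x X Y Z := by
  have h := isInvariantTrilinear_dcOmega hH hU hp hξ hg hJ
  have h1 := h.comp_left hU hp hH.smooth_J hJ
  exact (((h.sub (h1.comp_middle hU hp hH.smooth_J hJ)).sub
    (h1.comp_right hU hp hH.smooth_J hJ)).sub
    ((h.comp_middle hU hp hH.smooth_J hJ).comp_right hU hp hH.smooth_J hJ)).const_mul (1 / 4)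

theorem isInvariantTrilinear_dcOmegaPlus (hH : IsAlmostHermitian U g J) (hU : IsOpen U)
    (hp : p ∈ U) (hξ : ContDiffOn ℝ ∞ ξ U) (hg : IsInvariantForm U ξ g)
    (hJ : IsInvariantEnd U ξ J) :
    IsInvariantTrilinear ξ p fun x X Y Z => dcOmegaPlus g J x X Y Z :=
  (isInvariantTrilinear_dcOmega hH hU hp hξ hg hJ).sub
    (isInvariantTrilinear_dcOmegaMinus hH hU hp hξ hg hJ)

/-! ### The Nijenhuis tensor -/

/-- Vector-valued invariance, whence the extra dξ applied to the value. The d²ξ terms cancel by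
symmetry and J² = -1. -/
theorem hasDerivAt_nijenhuis (hH : IsAlmostHermitian U g J) (hU : IsOpen U) (hp : p ∈ U)
    (hξ : ContDiffOn ℝ ∞ ξ U) (hJ : IsInvariantEnd U ξ J)
    {X Y : ℝ → V m} {X' Y' : V m} (hX : HasDerivAt X X' 0) (hY : HasDerivAt Y Y' 0) :
    HasDerivAt (fun s : ℝ => nijenhuis J (p + s • ξ p) (X s) (Y s))
      (fderiv ℝ ξ p (nijenhuis J p (X 0) (Y 0))
        + nijenhuis J p (X' - fderiv ℝ ξ p (X 0)) (Y 0)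
        + nijenhuis J p (X 0) (Y' - fderiv ℝ ξ p (Y 0))) 0 := by
  have d := hasDerivAt_line (differentiableAt_fderiv_of_contDiffOn hH.smooth_J hU hp) (ξ p)
  have h2 := hJ.fderiv_fderiv hU hp hξ hH.smooth_J
  have hJX := hJ.hasDerivAt hU hp hH.smooth_J hX
  have hJY := hJ.hasDerivAt hU hp hH.smooth_J hY
  have hD := ((d.clm_apply hX).clm_apply hY).sub ((d.clm_apply hY).clm_apply hX)
  refine ((((d.clm_apply hJX).clm_apply hY).sub ((d.clm_apply hJY).clm_apply hX)).sub
    (hJ.hasDerivAt hU hp hH.smooth_J hD)).congr_deriv ?_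
  have s := fderiv_fderiv_symm_of_contDiffOn hξ hU hp
  have q := hH.J_sq p hp
  simp [h2, nijenhuis]
  rw [s (Y 0) (X 0), s (J p (Y 0)) (X 0), s (J p (X 0)) (Y 0),
    s (J p (Y 0)) (J p (X 0))]
  simp only [q]
  abel

theorem isInvariantTrilinear_nijenhuis (hH : IsAlmostHermitian U g J) (hU : IsOpen U)
    (hp : p ∈ U) (hξ : ContDiffOn ℝ ∞ ξ U) (hg : IsInvariantForm U ξ g)
    (hJ : IsInvariantEnd U ξ J) :
    IsInvariantTrilinear ξ p fun x X Y Z => g x X (nijenhuis J x Y Z) := by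
  intro X Y Z X' Y' Z' hX hY hZ
  refine (hg.hasDerivAt hU hp hH.smooth_g hX
    (hasDerivAt_nijenhuis hH hU hp hξ hJ hY hZ)).congr_deriv ?_
  simp
  ring

/-! ### The Levi-Civita and Gauduchon connections -/

/-- The Koszul form `g(D_X Y, Z)` on constant vector fields. -/
noncomputable def koszul (g : MetricField m) (x X Y Z : V m) : ℝ :=
  1 / 2 * (fderiv ℝ g x X Y Z + fderiv ℝ g x Y X Z - fderiv ℝ g x Z X Y)

theorem IsAlmostHermitian.apply_christoffel (hH : IsAlmostHermitian U g J) (hp : p ∈ U)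
    (X Y Z : V m) : g p (christoffel g p X Y) Z = koszul g p X Y Z := by
  rw [christoffel, hH.apply_sharp hp]
  simp [koszul]

/-- The Koszul form is not a tensor: symmetry of `g` and d²ξ cancels all d²ξ terms but one, the
inhomogeneous term in the transformation law of a connection. -/
theorem hasDerivAt_koszul (hH : IsAlmostHermitian U g J) (hU : IsOpen U) (hp : p ∈ U)
    (hξ : ContDiffOn ℝ ∞ ξ U) (hg : IsInvariantForm U ξ g)
    {X Y Z : ℝ → V m} {X' Y' Z' : V m} (hX : HasDerivAt X X' 0) (hY : HasDerivAt Y Y' 0)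
    (hZ : HasDerivAt Z Z' 0) :
    HasDerivAt (fun s : ℝ => koszul g (p + s • ξ p) (X s) (Y s) (Z s))
      (koszul g p (X' - fderiv ℝ ξ p (X 0)) (Y 0) (Z 0)
        + koszul g p (X 0) (Y' - fderiv ℝ ξ p (Y 0)) (Z 0)
        + koszul g p (X 0) (Y 0) (Z' - fderiv ℝ ξ p (Z 0))
        - g p (fderiv ℝ (fderiv ℝ ξ) p (X 0) (Y 0)) (Z 0)) 0 := by
  have d := hasDerivAt_line (differentiableAt_fderiv_of_contDiffOn hH.smooth_g hU hp) (ξ p)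
  have h2 := hg.fderiv_fderiv hU hp hξ hH.smooth_g
  refine (((((d.clm_apply hX).clm_apply hY).clm_apply hZ).add
    (((d.clm_apply hY).clm_apply hX).clm_apply hZ) |>.sub
    (((d.clm_apply hZ).clm_apply hX).clm_apply hY)).const_mul (1 / 2)).congr_deriv ?_
  have s := fderiv_fderiv_symm_of_contDiffOn hξ hU hp
  have n := hH.symm p hp
  simp [h2, koszul]
  rw [n (Y 0) (fderiv ℝ (fderiv ℝ ξ) p (X 0) (Z 0)), n (X 0) (fderiv ℝ (fderiv ℝ ξ) p (Y 0) (Z 0)),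
    n (X 0) (fderiv ℝ (fderiv ℝ ξ) p (Z 0) (Y 0)), s (Y 0) (X 0), s (Z 0) (X 0), s (Z 0) (Y 0)]
  ring

/-- The trilinear form `g(D_X Y - ∇ᵗ_X Y, Z)`. -/
noncomputable def gauduchonForm (g : MetricField m) (J : EndField m) (t : ℝ) (x X Y Z : V m) : ℝ :=
  (t + 1) / 4 * dcOmegaPlus g J x X (J x Y) (J x Z) + (t - 1) / 4 * dcOmegaPlus g J x X Y Z
    + 1 / 4 * g x X (nijenhuis J x Y Z) + 1 / 2 * dcOmegaMinus g J x X Y Z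

theorem IsAlmostHermitian.apply_gauduchon (hH : IsAlmostHermitian U g J) (hp : p ∈ U) (t : ℝ)
    (X Y Z : V m) : g p (gauduchon g J t p X Y) Z
      = koszul g p X Y Z - gauduchonForm g J t p X Y Z := by
  rw [gauduchon, map_sub, sub_apply, hH.apply_christoffel hp,
    hH.apply_sharp hp]
  simp [gauduchonForm]

theorem isInvariantTrilinear_gauduchonForm (hH : IsAlmostHermitian U g J) (hU : IsOpen U)
    (hp : p ∈ U) (hξ : ContDiffOn ℝ ∞ ξ U) (hg : IsInvariantForm U ξ g)
    (hJ : IsInvariantEnd U ξ J) (t : ℝ) :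
    IsInvariantTrilinear ξ p (gauduchonForm g J t) := by
  have hplus := isInvariantTrilinear_dcOmegaPlus hH hU hp hξ hg hJ
  exact (((((hplus.comp_middle hU hp hH.smooth_J hJ).comp_right hU hp hH.smooth_J hJ).const_mul
    ((t + 1) / 4)).add (hplus.const_mul ((t - 1) / 4))).add
    ((isInvariantTrilinear_nijenhuis hH hU hp hξ hg hJ).const_mul (1 / 4))).add
    ((isInvariantTrilinear_dcOmegaMinus hH hU hp hξ hg hJ).const_mul (1 / 2))

end Invariance

section Connection

variable {m : ℕ} {U : Set (V m)} {ξ η : V m → V m} {g : MetricField m} {J : EndField m} {p : V m}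

/-! ### Smoothness of the connection coefficients -/

theorem differentiableAt_cyclic {W : V m → V m →L[ℝ] V m →L[ℝ] V m →L[ℝ] ℝ} {X Y : V m → V m}
    (hW : DifferentiableAt ℝ W p) (hX : DifferentiableAt ℝ X p) (hY : DifferentiableAt ℝ Y p) :
    DifferentiableAt ℝ (fun x => ((W x).flip (X x)).flip (Y x)) p :=
  (differentiableAt_clm_flip ((differentiableAt_clm_flip hW).clm_apply hX)).clm_apply hY

theorem IsAlmostHermitian.differentiableAt_christoffel (hH : IsAlmostHermitian U g J)
    (hU : IsOpen U) (hp : p ∈ U) {X Y : V m → V m} (hX : DifferentiableAt ℝ X p)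
    (hY : DifferentiableAt ℝ Y p) :
    DifferentiableAt ℝ (fun x => christoffel g x (X x) (Y x)) p := by
  have d := differentiableAt_fderiv_of_contDiffOn hH.smooth_g hU hp
  have d' := differentiableAt_cyclic d hX hY
  unfold christoffel
  refine hH.differentiableAt_sharp (φ := fun x => (1 / 2 : ℝ) • (fderiv ℝ g x (X x) (Y x)
    + fderiv ℝ g x (Y x) (X x) - ((fderiv ℝ g x).flip (X x)).flip (Y x))) hU hp ?_
  fun_prop

theorem IsAlmostHermitian.differentiableAt_dcOmega (hH : IsAlmostHermitian U g J)
    (hU : IsOpen U) (hp : p ∈ U) {X Y : V m → V m} (hX : DifferentiableAt ℝ X p)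
    (hY : DifferentiableAt ℝ Y p) :
    DifferentiableAt ℝ (fun x => dcOmega g J x (X x) (Y x)) p := by
  have d := differentiableAt_fderiv_of_contDiffOn hH.smooth_omega hU hp
  have dJ := differentiableAt_of_contDiffOn hH.smooth_J hU hp
  have hJX := dJ.clm_apply hX
  have hJY := dJ.clm_apply hY
  exact ((((d.clm_apply hJX).clm_apply hJY).add
    (differentiableAt_clm_flip (d.clm_apply hJY) |>.clm_apply hJX)).add
    (differentiableAt_cyclic d hJX hJY)).clm_comp dJ

theorem IsAlmostHermitian.differentiableAt_dcOmegaMinus (hH : IsAlmostHermitian U g J)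
    (hU : IsOpen U) (hp : p ∈ U) {X Y : V m → V m} (hX : DifferentiableAt ℝ X p)
    (hY : DifferentiableAt ℝ Y p) :
    DifferentiableAt ℝ (fun x => dcOmegaMinus g J x (X x) (Y x)) p := by
  have dJ := differentiableAt_of_contDiffOn hH.smooth_J hU hp
  have hJX := dJ.clm_apply hX
  have hJY := dJ.clm_apply hY
  have h1 := hH.differentiableAt_dcOmega hU hp hX hY
  have h2 := hH.differentiableAt_dcOmega hU hp hJX hJY
  have h3 := hH.differentiableAt_dcOmega hU hp hJX hY
  have h4 := hH.differentiableAt_dcOmega hU hp hX hJY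
  exact (((h1.sub h2).sub (h3.clm_comp dJ)).sub (h4.clm_comp dJ)).const_smul (1 / 4 : ℝ)

theorem IsAlmostHermitian.differentiableAt_dcOmegaPlus (hH : IsAlmostHermitian U g J)
    (hU : IsOpen U) (hp : p ∈ U) {X Y : V m → V m} (hX : DifferentiableAt ℝ X p)
    (hY : DifferentiableAt ℝ Y p) :
    DifferentiableAt ℝ (fun x => dcOmegaPlus g J x (X x) (Y x)) p :=
  (hH.differentiableAt_dcOmega hU hp hX hY).sub (hH.differentiableAt_dcOmegaMinus hU hp hX hY)

theorem IsAlmostHermitian.differentiableAt_nijenhuis (hH : IsAlmostHermitian U g J)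
    (hU : IsOpen U) (hp : p ∈ U) {X : V m → V m} (hX : DifferentiableAt ℝ X p) :
    DifferentiableAt ℝ (fun x => nijenhuis J x (X x)) p := by
  have d := differentiableAt_fderiv_of_contDiffOn hH.smooth_J hU hp
  have dJ := differentiableAt_of_contDiffOn hH.smooth_J hU hp
  have df := (differentiableAt_clm_flip d).clm_apply hX
  exact ((d.clm_apply (dJ.clm_apply hX)).sub (df.clm_comp dJ)).sub
    (dJ.clm_comp ((d.clm_apply hX).sub df))

theorem IsAlmostHermitian.differentiableAt_gauduchon (hH : IsAlmostHermitian U g J)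
    (hU : IsOpen U) (hp : p ∈ U) (t : ℝ) {X Y : V m → V m} (hX : DifferentiableAt ℝ X p)
    (hY : DifferentiableAt ℝ Y p) :
    DifferentiableAt ℝ (fun x => gauduchon g J t x (X x) (Y x)) p := by
  have dJ := differentiableAt_of_contDiffOn hH.smooth_J hU hp
  have dg := differentiableAt_of_contDiffOn hH.smooth_g hU hp
  have h0 := hH.differentiableAt_christoffel hU hp hX hY
  have h1 := hH.differentiableAt_dcOmegaPlus hU hp hX (dJ.clm_apply hY)
  have h2 := hH.differentiableAt_dcOmegaPlus hU hp hX hY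
  have h3 := hH.differentiableAt_nijenhuis hU hp hY
  have h4 := hH.differentiableAt_dcOmegaMinus hU hp hX hY
  unfold gauduchon
  refine h0.sub (hH.differentiableAt_sharp (φ := fun x =>
    ((t + 1) / 4) • (dcOmegaPlus g J x (X x) (J x (Y x))).comp (J x)
      + ((t - 1) / 4) • dcOmegaPlus g J x (X x) (Y x)
      + (1 / 4 : ℝ) • (g x (X x)).comp (nijenhuis J x (Y x))
      + (1 / 2 : ℝ) • dcOmegaMinus g J x (X x) (Y x)) hU hp ?_)
  exact ((((h1.clm_comp dJ).const_smul ((t + 1) / 4)).add (h2.const_smul ((t - 1) / 4))).add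
    (((dg.clm_apply hX).clm_comp h3).const_smul (1 / 4 : ℝ))).add (h4.const_smul (1 / 2 : ℝ))

/-! ### Bilinearity and invariance of the connection coefficients -/

/-- The coefficients are not bundled as a bilinear map, so linearity is read off after pairing with
`g`. -/
theorem IsAlmostHermitian.gauduchon_add_left (hH : IsAlmostHermitian U g J) (hp : p ∈ U) (t : ℝ)
    (X X' Y : V m) :
    gauduchon g J t p (X + X') Y = gauduchon g J t p X Y + gauduchon g J t p X' Y := by
  refine hH.ext hp fun Z => ?_
  rw [map_add, add_apply]
  simp only [hH.apply_gauduchon hp]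
  simp [koszul, gauduchonForm, dcOmegaPlus, dcOmegaMinus, dcOmega, dOmega, nijenhuis]
  ring

theorem IsAlmostHermitian.gauduchon_neg_left (hH : IsAlmostHermitian U g J) (hp : p ∈ U) (t : ℝ)
    (X Y : V m) : gauduchon g J t p (-X) Y = -gauduchon g J t p X Y := by
  refine hH.ext hp fun Z => ?_
  rw [map_neg, neg_apply]
  simp only [hH.apply_gauduchon hp]
  simp [koszul, gauduchonForm, dcOmegaPlus, dcOmegaMinus, dcOmega, dOmega, nijenhuis]
  ring

theorem IsAlmostHermitian.gauduchon_add_right (hH : IsAlmostHermitian U g J) (hp : p ∈ U) (t : ℝ)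
    (X Y Y' : V m) :
    gauduchon g J t p X (Y + Y') = gauduchon g J t p X Y + gauduchon g J t p X Y' := by
  refine hH.ext hp fun Z => ?_
  rw [map_add, add_apply]
  simp only [hH.apply_gauduchon hp]
  simp [koszul, gauduchonForm, dcOmegaPlus, dcOmegaMinus, dcOmega, dOmega, nijenhuis]
  ring

theorem IsAlmostHermitian.gauduchon_neg_right (hH : IsAlmostHermitian U g J) (hp : p ∈ U) (t : ℝ)
    (X Y : V m) : gauduchon g J t p X (-Y) = -gauduchon g J t p X Y := by
  refine hH.ext hp fun Z => ?_
  rw [map_neg, neg_apply]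
  simp only [hH.apply_gauduchon hp]
  simp [koszul, gauduchonForm, dcOmegaPlus, dcOmegaMinus, dcOmega, dOmega, nijenhuis]
  ring

/-- The Gauduchon connections are preserved by `ξ`. -/
theorem fderiv_gauduchon (hH : IsAlmostHermitian U g J) (hU : IsOpen U) (hp : p ∈ U)
    (hξ : ContDiffOn ℝ ∞ ξ U) (hg : IsInvariantForm U ξ g) (hJ : IsInvariantEnd U ξ J) (t : ℝ)
    {X Y : V m → V m} (hX : DifferentiableAt ℝ X p) (hY : DifferentiableAt ℝ Y p) :
    fderiv ℝ (fun x => gauduchon g J t x (X x) (Y x)) p (ξ p) =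
      fderiv ℝ ξ p (gauduchon g J t p (X p) (Y p))
        + gauduchon g J t p (fderiv ℝ X p (ξ p) - fderiv ℝ ξ p (X p)) (Y p)
        + gauduchon g J t p (X p) (fderiv ℝ Y p (ξ p) - fderiv ℝ ξ p (Y p))
        - fderiv ℝ (fderiv ℝ ξ) p (X p) (Y p) := by
  refine hH.ext hp fun Z => ?_
  have dX := hasDerivAt_line hX (ξ p)
  have dY := hasDerivAt_line hY (ξ p)
  have dZ : HasDerivAt (fun _ : ℝ => Z) 0 0 := hasDerivAt_const _ _
  have dΓ := hasDerivAt_line (hH.differentiableAt_gauduchon hU hp t hX hY) (ξ p)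
  -- Differentiate g(Γ(X,Y), Z) = koszul - gauduchonForm along `ξ p` with `Z` constant: the left
  -- side by invariance of `g`, the right side by the invariance laws of its two terms.
  have L := hg.hasDerivAt hU hp hH.smooth_g dΓ dZ
  have R := (hasDerivAt_koszul hH hU hp hξ hg dX dY dZ).sub
    (isInvariantTrilinear_gauduchonForm hH hU hp hξ hg hJ t _ _ _ _ _ _ dX dY dZ)
  have E := L.unique (R.congr_of_eventuallyEq (by
    filter_upwards [eventually_line_mem hU hp (ξ p)] with s hs
    exact hH.apply_gauduchon hs t _ _ _))
  simp only [zero_smul, add_zero, map_sub, sub_apply, zero_sub] at E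
  simp only [map_sub, map_add, sub_apply, add_apply, hH.apply_gauduchon hp] at E ⊢
  linarith

/-- The curvature of a Gauduchon connection in the directions of two infinitesimal
automorphisms. -/
theorem curvature_gauduchon (hH : IsAlmostHermitian U g J) (hU : IsOpen U) (hp : p ∈ U)
    (hξ : ContDiffOn ℝ ∞ ξ U) (hgξ : IsInvariantForm U ξ g) (hJξ : IsInvariantEnd U ξ J)
    (hη : ContDiffOn ℝ ∞ η U) (hgη : IsInvariantForm U η g) (hJη : IsInvariantEnd U η J) (t : ℝ)
    {X Y Z : V m → V m} (hX : ContDiffOn ℝ ∞ X U) (hY : ContDiffOn ℝ ∞ Y U)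
    (hZ : ContDiffOn ℝ ∞ Z U) (hXp : X p = ξ p) (hYp : Y p = η p) :
    curvature (gauduchon g J t) X Y Z p =
      fderiv ℝ η p (gauduchon g J t p (ξ p) (Z p)) - fderiv ℝ ξ p (gauduchon g J t p (η p) (Z p))
        + gauduchon g J t p (fderiv ℝ ξ p (η p) - fderiv ℝ η p (ξ p)) (Z p)
        + gauduchon g J t p (η p) (fderiv ℝ ξ p (Z p))
        - gauduchon g J t p (ξ p) (fderiv ℝ η p (Z p))
        + fderiv ℝ (fderiv ℝ ξ) p (η p) (Z p) - fderiv ℝ (fderiv ℝ η) p (ξ p) (Z p)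
        - gauduchon g J t p (ξ p) (gauduchon g J t p (η p) (Z p))
        + gauduchon g J t p (η p) (gauduchon g J t p (ξ p) (Z p)) := by
  have dX := differentiableAt_of_contDiffOn hX hU hp
  have dY := differentiableAt_of_contDiffOn hY hU hp
  have dZ := differentiableAt_of_contDiffOn hZ hU hp
  have dZ' := differentiableAt_fderiv_of_contDiffOn hZ hU hp
  have key : ∀ {W : V m → V m}, DifferentiableAt ℝ W p → ∀ k,
      fderiv ℝ (nabla (gauduchon g J t) W Z) p k =
        fderiv ℝ (fderiv ℝ Z) p k (W p) + fderiv ℝ Z p (fderiv ℝ W p k)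
          + fderiv ℝ (fun x => gauduchon g J t x (W x) (Z x)) p k := by
    intro W dW k
    have h := (dZ'.hasFDerivAt.clm_apply dW.hasFDerivAt).add
      (hH.differentiableAt_gauduchon hU hp t dW dZ).hasFDerivAt
    have h' : HasFDerivAt (nabla (gauduchon g J t) W Z) _ p := h
    rw [h'.fderiv]
    simp
    abel
  have hx := fderiv_gauduchon hH hU hp hξ hgξ hJξ t dY dZ
  have hy := fderiv_gauduchon hH hU hp hη hgη hJη t dX dZ
  have s := fderiv_fderiv_symm_of_contDiffOn hZ hU hp (ξ p) (η p)
  unfold curvature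
  -- Only the outer covariant derivatives are unfolded; `key` differentiates the inner ones.
  conv_lhs => simp only [nabla.eq_def (gauduchon g J t) X (nabla _ _ _),
    nabla.eq_def (gauduchon g J t) Y (nabla _ _ _)]
  -- As `X p = ξ p` and `Y p = η p`, derivatives at `p` along `X` and `Y` are those along ξ and η.
  -- The derivatives of `X` and `Y` themselves then cancel against their bracket, and the second
  -- derivatives of `Z` cancel by symmetry.
  rw [hXp, hYp, key dY, key dX, hx, hy, hXp, hYp, s]
  simp only [nabla, VectorField.lieBracket, hXp, hYp, sub_eq_add_neg, map_add, map_neg,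
    hH.gauduchon_add_left hp, hH.gauduchon_neg_left hp, hH.gauduchon_add_right hp,
    hH.gauduchon_neg_right hp]
  abel

end Connection

theorem inner_stdI {m : ℕ} (X Y : V m) : inner ℝ (stdI m X) (stdI m Y) = inner ℝ X Y := by
  simp [PiLp.inner_apply, Fintype.sum_prod_type, Fin.sum_univ_two, stdI, add_comm]

namespace AttachedSpace

variable {m q : ℕ} {μ : Bracket m q} (M : AttachedSpace μ)

/-! ### The infinitesimal action -/

theorem isInvariantForm (a : G m q) : IsInvariantForm M.U (M.K a) M.g := by
  intro x hx Y Z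
  have d := differentiableAt_of_contDiffOn M.almostHermitian.smooth_g M.isOpen_U hx
  have h := M.killing a x hx Y Z
  have e := ((d.hasFDerivAt.clm_apply (hasFDerivAt_const Y x)).clm_apply
    (hasFDerivAt_const Z x)).fderiv
  rw [e] at h
  simp [VectorField.lieBracket] at h
  linarith

theorem isInvariantEnd (a : G m q) : IsInvariantEnd M.U (M.K a) M.J := by
  intro x hx Y
  have d := differentiableAt_of_contDiffOn M.almostHermitian.smooth_J M.isOpen_U hx
  have h := M.holomorphic a x hx Y
  have e := (d.hasFDerivAt.clm_apply (hasFDerivAt_const Y x)).fderiv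
  simp only [VectorField.lieBracket] at h
  rw [e] at h
  simp at h
  rw [← sub_eq_zero, ← h]
  abel

/-- The identification `e` as a linear map. -/
noncomputable def eLinear : V m →ₗ[ℝ] V m :=
  LinearMap.proj M.p ∘ₗ M.K ∘ₗ LinearMap.inr ℝ (EuclideanSpace ℝ (Fin q)) (V m)

theorem eLinear_apply (X : V m) : M.eLinear X = M.e X := rfl

theorem e_add (X Y : V m) : M.e (X + Y) = M.e X + M.e Y := map_add M.eLinear X Y

theorem e_sub (X Y : V m) : M.e (X - Y) = M.e X - M.e Y := map_sub M.eLinear X Y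

theorem e_neg (X : V m) : M.e (-X) = -M.e X := map_neg M.eLinear X

theorem g_e (X Y : V m) : M.g M.p (M.e X) (M.e Y) = inner ℝ X Y := M.isometry X Y

theorem J_e (X : V m) : M.J M.p (M.e X) = M.e (stdI m X) := M.complex X

/-- Being isometric, `e` is injective, hence bijective by dimension; identities at `p` need only be
tested on vectors `e Z`. -/
theorem e_surjective : Function.Surjective M.e := by
  have h : Function.Injective M.eLinear := by
    rw [← LinearMap.ker_eq_bot, LinearMap.ker_eq_bot']
    intro X hX
    have h0 := M.g_e X X
    rw [← eLinear_apply, hX] at h0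
    simpa using h0.symm
  exact LinearMap.surjective_of_injective h

theorem ext_e {v w : V m} (h : ∀ Z, M.g M.p v (M.e Z) = M.g M.p w (M.e Z)) : v = w := by
  refine M.almostHermitian.ext M.p_mem fun Z => ?_
  obtain ⟨Z, rfl⟩ := M.e_surjective Z
  exact h Z

theorem K_apply_p (a : G m q) : M.K a M.p = M.e a.2 := by
  have h : a = (a.1, 0) + (0, a.2) := by simp
  rw [h, map_add, Pi.add_apply, M.isotropy]
  simp [e]

theorem fderiv_K_sub (X Y : V m) :
    fderiv ℝ (M.K (0, X)) M.p (M.e Y) - fderiv ℝ (M.K (0, Y)) M.p (M.e X)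
      = M.e (muM μ X Y) := by
  have h := M.bracket_K (0, X) (0, Y) M.p M.p_mem
  rw [K_apply_p] at h
  rw [muM, ← neg_inj, ← h, VectorField.lieBracket, neg_sub]
  rfl

theorem fderiv_K_isotropy (Z : EuclideanSpace ℝ (Fin q)) (X : V m) :
    fderiv ℝ (M.K (Z, 0)) M.p (M.e X) = M.e (adM μ Z X) := by
  have h := M.bracket_K (Z, 0) (0, X) M.p M.p_mem
  rw [K_apply_p, VectorField.lieBracket, M.isotropy] at h
  simpa [adM, e] using h

theorem fderiv_K_add (a b : G m q) :
    fderiv ℝ (M.K (a + b)) M.p = fderiv ℝ (M.K a) M.p + fderiv ℝ (M.K b) M.p := by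
  rw [map_add]
  exact fderiv_add (differentiableAt_of_contDiffOn (M.smooth_K a) M.isOpen_U M.p_mem)
    (differentiableAt_of_contDiffOn (M.smooth_K b) M.isOpen_U M.p_mem)

/-- The derivative of the bracket relation at `p`. -/
theorem fderiv_bracket_K (X Y Z : V m) :
    fderiv ℝ (fderiv ℝ (M.K (0, Y))) M.p (M.e X) (M.e Z)
      + fderiv ℝ (M.K (0, Y)) M.p (fderiv ℝ (M.K (0, X)) M.p (M.e Z))
      - fderiv ℝ (fderiv ℝ (M.K (0, X))) M.p (M.e Y) (M.e Z)
      - fderiv ℝ (M.K (0, X)) M.p (fderiv ℝ (M.K (0, Y)) M.p (M.e Z))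
      = -M.e (adM μ (muH μ X Y) Z) - fderiv ℝ (M.K (0, muM μ X Y)) M.p (M.e Z) := by
  have d0 := fun a => hasDerivAt_line
    (differentiableAt_of_contDiffOn (M.smooth_K a) M.isOpen_U M.p_mem) (M.e Z)
  have d1 := fun a => hasDerivAt_line
    (differentiableAt_fderiv_of_contDiffOn (M.smooth_K a) M.isOpen_U M.p_mem) (M.e Z)
  have L := ((d1 (0, Y)).clm_apply (d0 (0, X))).sub ((d1 (0, X)).clm_apply (d0 (0, Y)))
  have E := L.unique ((d0 (μ (0, X) (0, Y))).neg.congr_of_eventuallyEq (by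
    filter_upwards [eventually_line_mem M.isOpen_U M.p_mem (M.e Z)] with s hs
    exact M.bracket_K (0, X) (0, Y) _ hs))
  -- The 𝔥-part acts through the isotropy representation, while the 𝔪-part remains as the
  -- differential of a field `K (0, ·)`.
  have hμ : μ (0, X) (0, Y) = (muH μ X Y, 0) + (0, muM μ X Y) := by simp [muH, muM]
  rw [hμ, fderiv_K_add, add_apply, fderiv_K_isotropy] at E
  simp only [zero_smul, add_zero, K_apply_p] at E
  rw [fderiv_fderiv_symm_of_contDiffOn (M.smooth_K _) M.isOpen_U M.p_mem (M.e X),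
    fderiv_fderiv_symm_of_contDiffOn (M.smooth_K _) M.isOpen_U M.p_mem (M.e Y)]
  rw [neg_add'] at E
  rw [← E]
  abel

/-! ### The tensors at the base point -/

theorem omega_e (X Y : V m) : omega M.g M.J M.p (M.e X) (M.e Y) = inner ℝ (stdI m X) Y := by
  rw [omega, ContinuousLinearMap.comp_apply, J_e, g_e]

/-- Invariance under K_X replaces ∂_{e X} ω by dK_X terms; skewness of ω groups the six terms into
three differences dK_X(e Y) - dK_Y(e X). -/
theorem dOmega_e (X Y Z : V m) : dOmega M.g M.J M.p (M.e X) (M.e Y) (M.e Z) =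
    -inner ℝ (stdI m (muM μ X Y)) Z - inner ℝ (stdI m (muM μ Y Z)) X
      - inner ℝ (stdI m (muM μ Z X)) Y := by
  have h := fun W => (M.isInvariantForm (0, W)).omega M.almostHermitian M.isOpen_U
    (M.isInvariantEnd (0, W)) M.p M.p_mem
  simp only [K_apply_p] at h
  have n := M.almostHermitian.omega_neg M.p_mem
  simp only [← M.omega_e, ← M.fderiv_K_sub, map_sub, sub_apply]
  simp only [dOmega, add_apply, ContinuousLinearMap.flip_apply, h]
  rw [n (M.e Y) (fderiv ℝ (M.K (0, X)) M.p (M.e Z)), n (M.e Z), n (M.e X)]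
  ring

theorem dcOmega_e (X Y Z : V m) :
    dcOmega M.g M.J M.p (M.e X) (M.e Y) (M.e Z) = F μ X Y Z := by
  simp only [dcOmega, ContinuousLinearMap.comp_apply, J_e, dOmega_e, inner_stdI, F]

theorem dcOmegaMinus_e (X Y Z : V m) :
    dcOmegaMinus M.g M.J M.p (M.e X) (M.e Y) (M.e Z) = Fminus μ X Y Z := by
  simp [dcOmegaMinus, J_e, dcOmega_e, Fminus]

theorem dcOmegaPlus_e (X Y Z : V m) :
    dcOmegaPlus M.g M.J M.p (M.e X) (M.e Y) (M.e Z) = Fplus μ X Y Z := by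
  simp [dcOmegaPlus, dcOmegaMinus_e, dcOmega_e, Fplus]

theorem nijenhuis_e (X Y : V m) : nijenhuis M.J M.p (M.e X) (M.e Y) = M.e (N μ X Y) := by
  have h := fun W => M.isInvariantEnd (0, W) M.p M.p_mem
  simp only [K_apply_p] at h
  have s := M.almostHermitian.J_sq M.p M.p_mem
  simp only [N, e_sub, e_add, ← M.J_e, ← M.fderiv_K_sub]
  simp only [nijenhuis, sub_apply, ContinuousLinearMap.comp_apply, ContinuousLinearMap.flip_apply,
    h, J_e, map_sub, map_add]
  simp only [← M.J_e, s]
  abel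

/-! ### The connections at the base point -/

/-- Substitute `L_K g = 0` into the Koszul formula: the dK terms pair into the three brackets of `S
μ`, apart from -dK_X(e Y). -/
theorem christoffel_e (X Y : V m) :
    christoffel M.g M.p (M.e X) (M.e Y)
      = -fderiv ℝ (M.K (0, X)) M.p (M.e Y) - M.e (S μ X Y) := by
  refine M.ext_e fun Z => ?_
  have h := fun W => M.isInvariantForm (0, W) M.p M.p_mem
  simp only [K_apply_p] at h
  have n := M.almostHermitian.symm M.p M.p_mem
  rw [M.almostHermitian.apply_christoffel M.p_mem, map_sub, sub_apply, g_e, inner_S, koszul]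
  simp only [← M.g_e, ← M.fderiv_K_sub, map_sub, map_neg, neg_apply, sub_apply, h]
  rw [n (M.e Y), n (M.e X) (fderiv ℝ (M.K (0, Y)) M.p (M.e Z)),
    n (M.e X) (fderiv ℝ (M.K (0, Z)) M.p (M.e Y))]
  ring

theorem gauduchonForm_e (t : ℝ) (X Y Z : V m) :
    gauduchonForm M.g M.J t M.p (M.e X) (M.e Y) (M.e Z)
      = inner ℝ (A μ t X Y) Z - inner ℝ (S μ X Y) Z := by
  simp only [gauduchonForm, J_e, dcOmegaPlus_e, dcOmegaMinus_e, nijenhuis_e, g_e, inner_A,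
    real_inner_comm X]
  ring

theorem gauduchon_e (t : ℝ) (X Y : V m) :
    gauduchon M.g M.J t M.p (M.e X) (M.e Y)
      = -fderiv ℝ (M.K (0, X)) M.p (M.e Y) - M.e (A μ t X Y) := by
  refine M.ext_e fun Z => ?_
  rw [M.almostHermitian.apply_gauduchon M.p_mem, ← M.almostHermitian.apply_christoffel M.p_mem,
    christoffel_e, gauduchonForm_e]
  simp only [map_sub, sub_apply, g_e]
  ring

theorem curvature_e (t : ℝ) {X Y Z : V m} {X' Y' Z' : V m → V m} (hX : ContDiffOn ℝ ∞ X' M.U)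
    (hY : ContDiffOn ℝ ∞ Y' M.U) (hZ : ContDiffOn ℝ ∞ Z' M.U) (hXp : X' M.p = M.e X)
    (hYp : Y' M.p = M.e Y) (hZp : Z' M.p = M.e Z) :
    curvature (gauduchon M.g M.J t) X' Y' Z' M.p
      = M.e (adM μ (muH μ X Y) Z - (A μ t X (A μ t Y Z) - A μ t Y (A μ t X Z))
          - A μ t (muM μ X Y) Z) := by
  have hH := M.almostHermitian
  rw [curvature_gauduchon hH M.isOpen_U M.p_mem
    (M.smooth_K (0, X)) (M.isInvariantForm _) (M.isInvariantEnd _) (M.smooth_K (0, Y))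
    (M.isInvariantForm _) (M.isInvariantEnd _) t hX hY hZ hXp hYp]
  simp only [K_apply_p, hZp, fderiv_K_sub]
  simp only [gauduchon_e, sub_eq_add_neg, map_add, map_neg,
    hH.gauduchon_add_right M.p_mem, hH.gauduchon_neg_right M.p_mem, e_add, e_neg]
  -- The second derivatives of K_X and K_Y occur exactly in the combination that this relation
  -- evaluates.
  have hB := M.fderiv_bracket_K X Y Z
  rw [eq_sub_iff_add_eq] at hB
  rw [eq_neg_iff_add_eq_zero.1 hB |> eq_neg_of_add_eq_zero_right]
  abel

end AttachedSpace

end GauduchonHomogeneous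

theorem mainTheorem8 {m q : ℕ} (μ : GauduchonHomogeneous.Bracket m q)
    (hμ : GauduchonHomogeneous.IsUnitaryTransitive μ)
    (M : GauduchonHomogeneous.AttachedSpace μ) (t : ℝ) :
    -- `F^μ` is the three-form `dᶜω`, and `N^μ` is the Nijenhuis tensor
    (∀ X Y Z : GauduchonHomogeneous.V m,
      GauduchonHomogeneous.dcOmega M.g M.J M.p (M.e X) (M.e Y) (M.e Z)
        = GauduchonHomogeneous.F μ X Y Z) ∧
    (∀ X Y : GauduchonHomogeneous.V m,
      GauduchonHomogeneous.nijenhuis M.J M.p (M.e X) (M.e Y)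
        = M.e (GauduchonHomogeneous.N μ X Y)) ∧
    -- `S^μ` and `A^{t,μ}` compare the Ambrose-Singer connection with `D` and with `∇ᵗ`
    (∀ (X Y : GauduchonHomogeneous.V m)
      (W : GauduchonHomogeneous.V m → GauduchonHomogeneous.V m),
      ContDiffOn ℝ ∞ W M.U → W M.p = M.e Y →
      M.ambroseSinger X W
          - GauduchonHomogeneous.nabla (GauduchonHomogeneous.christoffel M.g)
              (M.K (0, X)) W M.p
        = M.e (GauduchonHomogeneous.S μ X Y)) ∧
    (∀ (X Y : GauduchonHomogeneous.V m)
      (W : GauduchonHomogeneous.V m → GauduchonHomogeneous.V m),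
      ContDiffOn ℝ ∞ W M.U → W M.p = M.e Y →
      M.ambroseSinger X W
          - GauduchonHomogeneous.nabla (GauduchonHomogeneous.gauduchon M.g M.J t)
              (M.K (0, X)) W M.p
        = M.e (GauduchonHomogeneous.A μ t X Y)) ∧
    -- the torsion and the curvature of the `t`-Gauduchon connection
    (∀ (X Y : GauduchonHomogeneous.V m)
      (X' Y' : GauduchonHomogeneous.V m → GauduchonHomogeneous.V m),
      ContDiffOn ℝ ∞ X' M.U → ContDiffOn ℝ ∞ Y' M.U →
      X' M.p = M.e X → Y' M.p = M.e Y →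
      GauduchonHomogeneous.torsion (GauduchonHomogeneous.gauduchon M.g M.J t) X' Y' M.p
        = M.e (-GauduchonHomogeneous.A μ t X Y + GauduchonHomogeneous.A μ t Y X
            - GauduchonHomogeneous.muM μ X Y)) ∧
    (∀ (X Y Z : GauduchonHomogeneous.V m)
      (X' Y' Z' : GauduchonHomogeneous.V m → GauduchonHomogeneous.V m),
      ContDiffOn ℝ ∞ X' M.U → ContDiffOn ℝ ∞ Y' M.U → ContDiffOn ℝ ∞ Z' M.U →
      X' M.p = M.e X → Y' M.p = M.e Y → Z' M.p = M.e Z →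
      GauduchonHomogeneous.curvature (GauduchonHomogeneous.gauduchon M.g M.J t) X' Y' Z' M.p
        = M.e (GauduchonHomogeneous.adM μ (GauduchonHomogeneous.muH μ X Y) Z
            - (GauduchonHomogeneous.A μ t X (GauduchonHomogeneous.A μ t Y Z)
                - GauduchonHomogeneous.A μ t Y (GauduchonHomogeneous.A μ t X Z))
            - GauduchonHomogeneous.A μ t (GauduchonHomogeneous.muM μ X Y) Z)) := by
  refine ⟨M.dcOmega_e, M.nijenhuis_e, fun X Y W _ hW => ?_, fun X Y W _ hW => ?_,
    fun X Y X' Y' _ _ hX hY => ?_,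
    fun X Y Z X' Y' Z' hX hY hZ hXp hYp hZp => M.curvature_e t hX hY hZ hXp hYp hZp⟩
  -- The derivative of `W` along K_X cancels, leaving -dK_X(e Y) minus the connection coefficient.
  · simp only [GauduchonHomogeneous.AttachedSpace.ambroseSinger, VectorField.lieBracket,
      GauduchonHomogeneous.nabla, hW, M.K_apply_p, M.christoffel_e]
    abel
  · simp only [GauduchonHomogeneous.AttachedSpace.ambroseSinger, VectorField.lieBracket,
      GauduchonHomogeneous.nabla, hW, M.K_apply_p, M.gauduchon_e]
    abel
  -- The derivatives of `X'` and `Y'` cancel against their bracket; the skew part of the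
  -- coefficients remains.
  · simp only [GauduchonHomogeneous.torsion, VectorField.lieBracket,
      GauduchonHomogeneous.nabla, hX, hY, M.gauduchon_e, M.e_sub, M.e_add, M.e_neg,
      ← M.fderiv_K_sub]
    abel
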